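/- Let $0<\mu<1$ and $\sigma>0$. For $n\ge 1$ one observes $(X_1,Y_1),\dots,(X_n,Y_n)$ with $$Y_i=\mathbf 1(X_i\in G)+\xi_i,\qquad i=1,\dots,n,$$ where $G=[a,b]$, $0\le a\le b\le 1$, is an unknown segment, and the noise terms $\xi_1,\dots,\xi_n$ are i.i.d., independent of the design $(X_1,\dots,X_n)$ and subgaussian: $\mathbb E[e^{u\xi_i}]\le e^{\sigma^2u^2/2}$ for all $u\in\mathbb R$. The design is either (DD) deterministic and regular, $X_i=i/n$, or (RD) random and uniform, i.e. $X_1\le\dots\le X_n$ is the increasing reordering of $n$ i.i.d. uniform random variables on $[0,1]$. Let $\mathcal S(\mu)$ be the class of segments $G\subseteq[0,1]$ with length $|G|\ge\mu$, and let $$\mathcal R_n(\mathcal S(\mu))=\inf_{\hat G_n}\ \sup_{G\in\mathcal S(\mu)}\mathbb E_G\big[|G\triangle\hat G_n|\big]$$ be the minimax risk, where $|\cdot|$ is Lebesgue measure, $\triangle$ is the symmetric difference, $\mathbb E_G$ is the expectation when $G$ is the true segment, and the infimum is over all estimators $\hat G_n$, i.e. (possibly empty) segments of $[0,1]$ that depend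 measurably on the $n$ observations. Then, for each of the designs (DD) and (RD), $$\mathcal R_n(\mathcal S(\mu))\asymp_{\mu,\sigma}\frac1n :$$ there are constants $c,C>0$ and an integer $N$, depending only on $\mu$ and $\sigma$ (and not on the noise distribution), such that $$\frac cn\le\mathcal R_n(\mathcal S(\mu))\le\frac Cn\qquad\text{for all } n\ge N.$$ -/

import Mathlib

open MeasureTheory ProbabilityTheory Set
open scoped ENNReal NNReal

noncomputable section

namespace ChangePoint

/-- The class of all segments `[a, b]` with `0 ≤ a ≤ b ≤ 1`. -/
def segments : Set (Set ℝ) :=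
  {G | ∃ a b : ℝ, 0 ≤ a ∧ a ≤ b ∧ b ≤ 1 ∧ G = Icc a b}

/-- The class of segments in `[0, 1]` of length at least `μ`. -/
def longSegments (μ : ℝ) : Set (Set ℝ) :=
  {G | G ∈ segments ∧ ENNReal.ofReal μ ≤ volume G}

/-- The law of the deterministic regular design `X_i = i / n`, `i = 1, …, n`
(the index `i : Fin n` starts at `0`). -/
def designDD (n : ℕ) : Measure (Fin n → ℝ) :=
  Measure.dirac fun i => ((i : ℝ) + 1) / (n : ℝ)

/-- The increasing reordering of a vector. -/
def reorder {n : ℕ} (x : Fin n → ℝ) : Fin n → ℝ := x ∘ Tuple.sort x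

/-- The law of the random uniform design: the increasing reordering of `n` i.i.d. random variables
that are uniform on `[0, 1]`. -/
def designRD (n : ℕ) : Measure (Fin n → ℝ) :=
  (Measure.pi fun _ : Fin n => (volume : Measure ℝ).restrict (Icc 0 1)).map reorder

/-- The observations `(X_i, Y_i)`, where `Y_i = 1(X_i ∈ G) + ξ_i`. -/
def observe {n : ℕ} (G : Set ℝ) (x ξ : Fin n → ℝ) : Fin n → ℝ × ℝ :=
  fun i => (x i, G.indicator 1 (x i) + ξ i)

/-- The joint law `ℙ_G` of the observations when the design has law `D` and the noise terms are
i.i.d. with law `ν` and independent of the design. -/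
def obsLaw {n : ℕ} (D : Measure (Fin n → ℝ)) (ν : Measure ℝ) (G : Set ℝ) :
    Measure (Fin n → ℝ × ℝ) :=
  (D.prod (Measure.pi fun _ : Fin n => ν)).map fun p => observe G p.1 p.2

/-- An estimator based on `n` observations: a (possibly empty) segment `[lo, hi]` of `[0, 1]`
whose endpoints are measurable functions of the observations. The segment is empty when
`hi < lo`. -/
structure Estimator (n : ℕ) where
  lo : (Fin n → ℝ × ℝ) → ℝ
  hi : (Fin n → ℝ × ℝ) → ℝ
  measurable_lo : Measurable lo
  measurable_hi : Measurable hi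
  lo_nonneg : ∀ z, 0 ≤ lo z
  hi_le_one : ∀ z, hi z ≤ 1

/-- The segment estimated from the observations `z`. -/
def Estimator.seg {n : ℕ} (T : Estimator n) (z : Fin n → ℝ × ℝ) : Set ℝ :=
  Icc (T.lo z) (T.hi z)

/-- The risk `sup_{G ∈ C} 𝔼_G |G ∆ Ĝ|` of an estimator on a class `C` of segments. -/
def risk {n : ℕ} (D : Measure (Fin n → ℝ)) (ν : Measure ℝ) (C : Set (Set ℝ))
    (T : Estimator n) : ℝ≥0∞ :=
  ⨆ G ∈ C, ∫⁻ z, volume (symmDiff G (T.seg z)) ∂(obsLaw D ν G)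

/-- The minimax risk on a class `C` of segments: the infimum of the risk over all estimators. -/
def minimaxRisk {n : ℕ} (D : Measure (Fin n → ℝ)) (ν : Measure ℝ) (C : Set (Set ℝ)) : ℝ≥0∞ :=
  ⨅ T : Estimator n, risk D ν C T

/-- Reordering is measurable, so that the law of the random design is a genuine image measure. -/
theorem measurable_reorder {n : ℕ} : Measurable (reorder : (Fin n → ℝ) → Fin n → ℝ) := by
  have hs : ∀ s : Equiv.Perm (Fin n), MeasurableSet {x : Fin n → ℝ | Tuple.sort x = s} := by
    intro s
    have : {x : Fin n → ℝ | Tuple.sort x = s} =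
        ⋂ i, ⋂ j, {x | i < j → x (s i) < x (s j) ∨ (x (s i) = x (s j) ∧ s i < s j)} := by
      ext x
      simp only [mem_ofPred_eq, mem_iInter]
      rw [eq_comm, Tuple.eq_sort_iff']
      constructor
      · intro h i j hij
        have h1 := h hij
        simp only [Tuple.graphEquiv₁, Equiv.trans_apply] at h1
        rcases (Prod.Lex.lt_iff.1 h1) with h2 | h2
        · exact Or.inl h2
        · exact Or.inr h2
      · intro h i j hij
        have h1 := h i j hij
        exact Prod.Lex.lt_iff.2 h1
    rw [this]
    refine MeasurableSet.iInter fun i => MeasurableSet.iInter fun j => ?_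
    by_cases hij : i < j
    · simp only [hij, true_imp_iff]
      exact (measurableSet_lt (measurable_pi_apply (s i)) (measurable_pi_apply (s j))).union
        ((measurableSet_eq_fun (measurable_pi_apply (s i)) (measurable_pi_apply (s j))).inter
          (MeasurableSet.const _))
    · simp [hij]
  have hm : ∀ s : Equiv.Perm (Fin n), Measurable fun x : Fin n → ℝ => x ∘ s := fun s =>
    measurable_pi_lambda (fun x : Fin n → ℝ => x ∘ s) fun i => measurable_pi_apply (s i)
  intro A hA
  have : reorder ⁻¹' A = ⋃ s : Equiv.Perm (Fin n),
      {x : Fin n → ℝ | Tuple.sort x = s} ∩ (fun x : Fin n → ℝ => x ∘ s) ⁻¹' A := by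
    ext x
    simp [reorder]
  rw [this]
  exact MeasurableSet.iUnion fun s => (hs s).inter
    (hm s hA)

end ChangePoint

end

/-!
**Lower bound.** The segments `[0, 1 - 3 / (4n)]` and `[0, 1 - 1 / (4n)]` differ by a set of measure
`1 / (2n)`. This set contains no design point in the deterministic case, and with probability at
least `1 / 2` none in the random case. On that event the observations are the same for both segments,
whatever the noise, so no estimator is close to both
(`volume_symmDiff_div_four_le_minimaxRisk`, `gap_designDD`, `gap_designRD`).

**Upper bound.** The estimator is the least squares one among the segments `[p / n, q / n]`: it
maximizes `score A = ∑ (Y_i - 1 / 2) 1(X_i ∈ A)` over `A = (p / n, q / n]`. Let `A₀ ⊆ G` be the inner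
grid approximation of the true segment `G`. As `A` is selected only if `score A₀ ≤ score A`, the
indicator of that event is at most `exp (t (score A - score A₀))`, and the risk is at most the sum
over `A` of the loss of `A` times the expectation of this exponential. For `t = 1 / (2 σ²)` every
design point in `A₀ ∆ A` contributes a factor at most `exp (-1 / (8 σ²)) < 1`, except those in
`G \ A₀`, of which there are at most two on average (`lintegral_exp_score_sub_le`). Both designs are
treated at once through their intensity (`IsDesignIntensity`), a measure that replaces the number of
design points in a set. For the random design the sorting plays no role here, because the noise is
integrated out first and leaves a symmetric function of the design.

The expectation is therefore at most `K exp (-θ l)`, where `l` is the sum of the distances, in grid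
steps, between the endpoints of `A` and `A₀`. This uses `|G| ≥ μ`: for overlapping segments
`n |A₀ ∆ A| = l`, and for disjoint ones `n |A₀ ∆ A| ≥ n |A₀|` is still of the order of `l`
(`IsDesignIntensity.le_real_symmDiff`). The loss is at most `(l + 2) / n`, and the double series of
`(l + 2) exp (-θ l)` converges (`sum_loss_mul_exp_le`), so that there is no logarithmic factor.
-/

namespace ChangePoint

/-! ### Lower bound: two segments that the design does not separate -/

theorem measurable_observe {n : ℕ} {G : Set ℝ} (hG : MeasurableSet G) :
    Measurable fun p : (Fin n → ℝ) × (Fin n → ℝ) => observe G p.1 p.2 := by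
  refine measurable_pi_lambda _ fun i => ?_
  have h1 : Measurable fun p : (Fin n → ℝ) × (Fin n → ℝ) => p.1 i :=
    (measurable_pi_apply i).comp measurable_fst
  have h2 : Measurable fun p : (Fin n → ℝ) × (Fin n → ℝ) => p.2 i :=
    (measurable_pi_apply i).comp measurable_snd
  exact h1.prodMk (((measurable_one.indicator hG).comp h1).add h2)

/-- The loss of an estimator is a measurable function of the observations, so that its integral is
the genuine expected loss. -/
theorem Estimator.measurable_volume_symmDiff {n : ℕ} (T : Estimator n) {G : Set ℝ}
    (hG : MeasurableSet G) : Measurable fun z => volume (symmDiff G (T.seg z)) := by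
  have hs : MeasurableSet {p : (Fin n → ℝ × ℝ) × ℝ | p.2 ∈ T.seg p.1} :=
    (measurableSet_le (T.measurable_lo.comp measurable_fst) measurable_snd).inter
      (measurableSet_le measurable_snd (T.measurable_hi.comp measurable_fst))
  have hG' : MeasurableSet {p : (Fin n → ℝ × ℝ) × ℝ | p.2 ∈ G} := measurable_snd hG
  exact measurable_measure_prodMk_left (ν := volume) (hG'.symmDiff hs)

/-- Two-point bound: if with probability at least `1 / 2` the design does not separate two segments
of the class, then the observations do not tell them apart, and the risk is at least a quarter of
their distance. -/
theorem volume_symmDiff_div_four_le_minimaxRisk {n : ℕ} (D : Measure (Fin n → ℝ)) [SFinite D]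
    (ν : Measure ℝ) [IsProbabilityMeasure ν] {C : Set (Set ℝ)} {G₁ G₂ : Set ℝ}
    (h₁ : G₁ ∈ C) (h₂ : G₂ ∈ C) (hG₁ : MeasurableSet G₁) (hG₂ : MeasurableSet G₂)
    (hD : 2⁻¹ ≤ D {x | ∀ i, x i ∉ symmDiff G₁ G₂}) :
    volume (symmDiff G₁ G₂) / 4 ≤ minimaxRisk D ν C := by
  refine le_iInf fun T => ?_
  set E : Set (Fin n → ℝ) := {x | ∀ i, x i ∉ symmDiff G₁ G₂} with hE
  have hEm : MeasurableSet E := by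
    simp only [hE, Set.ofPred_forall]
    exact MeasurableSet.iInter fun i =>
      measurable_pi_apply (X := fun _ => ℝ) i (hG₁.symmDiff hG₂).compl
  set P := D.prod (Measure.pi fun _ : Fin n => ν)
  have hr : ∀ {G : Set ℝ}, G ∈ C → MeasurableSet G →
      ∫⁻ p, volume (symmDiff G (T.seg (observe G p.1 p.2))) ∂P ≤ risk D ν C T := by
    intro G h hG
    have : ∫⁻ p, volume (symmDiff G (T.seg (observe G p.1 p.2))) ∂P =
        ∫⁻ z, volume (symmDiff G (T.seg z)) ∂(obsLaw D ν G) :=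
      (lintegral_map (T.measurable_volume_symmDiff hG) (measurable_observe hG)).symm
    rw [this]
    exact le_iSup₂ (f := fun G (_ : G ∈ C) => ∫⁻ z, volume (symmDiff G (T.seg z))
      ∂(obsLaw D ν G)) G h
  have hobs : ∀ p ∈ E ×ˢ (univ : Set (Fin n → ℝ)), observe G₁ p.1 p.2 = observe G₂ p.1 p.2 := by
    rintro ⟨x, ξ⟩ hp
    funext i
    have hx : x i ∉ symmDiff G₁ G₂ := hp.1 i
    have : x i ∈ G₁ ↔ x i ∈ G₂ := by
      rw [mem_symmDiff] at hx; tauto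
    by_cases h : x i ∈ G₁
    · simp [observe, h, this.1 h]
    · simp [observe, h, mt this.2 h]
  have hsum : volume (symmDiff G₁ G₂) * 2⁻¹ ≤ risk D ν C T + risk D ν C T := by
    calc volume (symmDiff G₁ G₂) * 2⁻¹
        ≤ volume (symmDiff G₁ G₂) * P (E ×ˢ univ) := by
          rw [Measure.prod_prod]; simpa using mul_le_mul_right hD _
      _ = ∫⁻ p in E ×ˢ univ, volume (symmDiff G₁ G₂) ∂P := by simp
      _ ≤ ∫⁻ p in E ×ˢ univ, (volume (symmDiff G₁ (T.seg (observe G₁ p.1 p.2))) +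
            volume (symmDiff G₂ (T.seg (observe G₂ p.1 p.2)))) ∂P := by
          refine setLIntegral_mono' (hEm.prod MeasurableSet.univ) fun p hp => ?_
          rw [hobs p hp, symmDiff_comm G₂ (T.seg _)]
          exact measure_symmDiff_le _ _ _
      _ ≤ ∫⁻ p, (volume (symmDiff G₁ (T.seg (observe G₁ p.1 p.2))) +
            volume (symmDiff G₂ (T.seg (observe G₂ p.1 p.2)))) ∂P := setLIntegral_le_lintegral _ _
      _ = _ := lintegral_add_left
          ((T.measurable_volume_symmDiff hG₁).comp (measurable_observe hG₁)) _
      _ ≤ _ := add_le_add (hr h₁ hG₁) (hr h₂ hG₂)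
  rw [← two_mul] at hsum
  rw [ENNReal.div_le_iff (by norm_num) (by norm_num)]
  calc volume (symmDiff G₁ G₂) = volume (symmDiff G₁ G₂) * 2⁻¹ * 2 := by
        rw [mul_assoc, ENNReal.inv_mul_cancel (by norm_num) (by norm_num), mul_one]
    _ ≤ 2 * risk D ν C T * 2 := by gcongr
    _ = risk D ν C T * 4 := by rw [mul_comm, ← mul_assoc]; norm_num [mul_comm]

/-- If the gap `(1 - 3 / (4n), 1 - 1 / (4n)]` is free of design points with probability at least
`1 / 2`, the minimax risk is at least `1 / (8n)`, whatever the noise. -/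
theorem le_minimaxRisk_of_gap {n : ℕ} (D : Measure (Fin n → ℝ)) [SFinite D]
    (ν : Measure ℝ) [IsProbabilityMeasure ν] {μ : ℝ} (hμ1 : μ < 1) (hn : 1 ≤ (1 - μ) * n)
    (hμ0 : 0 < μ)
    (hD : 2⁻¹ ≤ D {x | ∀ i, x i ∉ Ioc (1 - 3 / (4 * n) : ℝ) (1 - 1 / (4 * n))}) :
    ENNReal.ofReal (1 / 8 / n) ≤ minimaxRisk D ν (longSegments μ) := by
  have hn0 : (0 : ℝ) < n := by
    by_contra h
    nlinarith [sub_pos.2 hμ1]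
  have e : ∀ c : ℝ, c / (4 * n) = c / 4 * (1 / n) := fun c => by field_simp
  have hinv : (1 : ℝ) / n ≤ 1 - μ := by rw [div_le_iff₀ hn0]; exact hn
  have hinv0 : (0 : ℝ) < 1 / n := by positivity
  have hmem : ∀ b : ℝ, μ ≤ b → b ≤ 1 → Icc 0 b ∈ longSegments μ := fun b h h' =>
    ⟨⟨0, b, le_rfl, hμ0.le.trans h, h', rfl⟩, by
      rw [Real.volume_Icc]; exact ENNReal.ofReal_le_ofReal (by linarith)⟩
  have hsd : symmDiff (Icc (0 : ℝ) (1 - 3 / (4 * n))) (Icc 0 (1 - 1 / (4 * n))) =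
      Ioc (1 - 3 / (4 * n) : ℝ) (1 - 1 / (4 * n)) := by
    ext x
    simp only [e, mem_symmDiff, mem_Icc, mem_Ioc]
    constructor
    · rintro (⟨⟨h1, h2⟩, h3⟩ | ⟨⟨h1, h2⟩, h3⟩)
      · exact absurd ⟨h1, by linarith⟩ h3
      · exact ⟨not_le.1 fun h => h3 ⟨h1, h⟩, h2⟩
    · rintro ⟨h1, h2⟩
      exact Or.inr ⟨⟨by linarith, h2⟩, fun h => by linarith [h.2]⟩
  have := volume_symmDiff_div_four_le_minimaxRisk D ν
    (hmem (1 - 3 / (4 * n)) (by rw [e]; linarith) (by rw [e]; linarith))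
    (hmem (1 - 1 / (4 * n)) (by rw [e]; linarith) (by rw [e]; linarith))
    measurableSet_Icc measurableSet_Icc (by rwa [hsd])
  refine le_trans (le_of_eq ?_) this
  rw [hsd, Real.volume_Ioc, show (4 : ℝ≥0∞) = ENNReal.ofReal 4 by simp,
    ← ENNReal.ofReal_div_of_pos (by norm_num)]
  congr 1
  field_simp
  norm_num

/-! ### Intensity of a design -/

theorem lintegral_pi_prod_eq {n : ℕ} (m : Measure ℝ) [IsProbabilityMeasure m]
    {f : Fin n → ℝ → ℝ≥0∞} (hf : ∀ i, Measurable (f i)) :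
    ∫⁻ x, ∏ i, f i (x i) ∂(Measure.pi fun _ : Fin n => m) = ∏ i, ∫⁻ t, f i t ∂m := by
  have hi := iIndepFun_pi (μ := fun _ : Fin n => m) (X := f) fun i => (hf i).aemeasurable
  rw [lintegral_prod_eq_prod_lintegral_of_indepFun Finset.univ _ hi
    fun i => (hf i).comp (measurable_pi_apply i)]
  refine Finset.prod_congr rfl fun i _ => ?_
  exact (measurePreserving_eval (fun _ : Fin n => m) i).lintegral_comp (hf i)

/-- `κ` controls the design with law `D`: products over the design points are bounded by the
exponential of an integral against `κ`, and `κ` gives mass one to the cells of the regular grid of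
mesh `1 / n`. For the deterministic design `κ` is the counting measure of the design points, for the
random design it is `n` times the uniform law. -/
structure IsDesignIntensity {n : ℕ} (D : Measure (Fin n → ℝ)) (κ : Measure ℝ) : Prop where
  isFiniteMeasure : IsFiniteMeasure κ
  lintegral_prod_le : ∀ h : ℝ → ℝ, Measurable h → (∀ x, -1 ≤ h x) → Integrable h κ →
    ∫⁻ x, ∏ i, ENNReal.ofReal (1 + h (x i)) ∂D ≤ ENNReal.ofReal (Real.exp (∫ x, h x ∂κ))
  real_Ioc_grid : ∀ p q : ℕ, p ≤ q → q ≤ n → κ.real (Ioc (p / n : ℝ) (q / n)) = q - p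
  real_Ioc_cell_le : ∀ s : ℝ, κ.real (Ioc s (s + 1 / n)) ≤ 1

theorem isProbabilityMeasure_restrict_Icc :
    IsProbabilityMeasure ((volume : Measure ℝ).restrict (Icc 0 1)) := ⟨by simp⟩

/-- The intensity of the deterministic design: the counting measure of the points `i / n`. -/
noncomputable def intensityDD (n : ℕ) : Measure ℝ :=
  ∑ i : Fin n, Measure.dirac (((i : ℝ) + 1) / n)

theorem intensityDD_real {n : ℕ} {s : Set ℝ} (hs : MeasurableSet s) :
    (intensityDD n).real s =
      (({i : Fin n | ((i : ℝ) + 1) / n ∈ s} : Set (Fin n)).ncard : ℝ) := by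
  classical
  rw [Set.ncard_eq_toFinset_card', Finset.card_eq_sum_ones, Measure.real, intensityDD,
    Measure.finsetSum_apply]
  simp [Measure.dirac_apply' _ hs, Set.indicator_apply, Finset.sum_boole]

theorem isDesignIntensity_designDD {n : ℕ} (hn : 0 < n) :
    IsDesignIntensity (designDD n) (intensityDD n) := by
  have hn0 : (0 : ℝ) < n := by exact_mod_cast hn
  refine ⟨by unfold intensityDD; infer_instance, ?_, ?_, ?_⟩
  · intro h hm h1 hi
    have hmeas : Measurable fun x : Fin n → ℝ => ∏ i, ENNReal.ofReal (1 + h (x i)) :=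
      Finset.measurable_prod _ fun i _ =>
        ((hm.comp (measurable_pi_apply i)).const_add 1).ennreal_ofReal
    rw [designDD, lintegral_dirac' _ hmeas,
      ← ENNReal.ofReal_prod_of_nonneg fun i _ => by linarith [h1 (((i : ℝ) + 1) / n)]]
    refine ENNReal.ofReal_le_ofReal ?_
    have : ∫ x, h x ∂(intensityDD n) = ∑ i : Fin n, h (((i : ℝ) + 1) / n) := by
      rw [intensityDD, integral_finsetSum_measure]
      · simp [integral_dirac' _ _ hm.stronglyMeasurable]
      · intro i _
        exact integrable_dirac' hm.stronglyMeasurable (by simp)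
    rw [this, Real.exp_sum]
    refine Finset.prod_le_prod (fun i _ => by linarith [h1 (((i : ℝ) + 1) / n)]) fun i _ => ?_
    rw [add_comm]; exact Real.add_one_le_exp _
  · intro p q hpq hq
    rw [intensityDD_real measurableSet_Ioc, ← Nat.cast_sub hpq, Nat.cast_inj]
    have : ({i : Fin n | ((i : ℝ) + 1) / n ∈ Ioc (p / n : ℝ) (q / n)} : Set (Fin n)) =
        Fin.val ⁻¹' (Ico p q) := by
      ext i
      simp only [mem_ofPred_eq, mem_Ioc, mem_preimage, mem_Ico, div_lt_div_iff_of_pos_right hn0,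
        div_le_div_iff_of_pos_right hn0]
      norm_cast
      omega
    rw [this, Set.ncard_preimage_of_injective_subset_range Fin.val_injective]
    · simp [← Finset.coe_Ico, Set.ncard_coe_finset]
    · intro k hk
      exact ⟨⟨k, hk.2.trans_le hq⟩, rfl⟩
  · intro s
    rw [intensityDD_real measurableSet_Ioc]
    refine Nat.cast_le_one.2 ?_
    refine (Set.ncard_le_one (Set.toFinite _)).2 ?_
    intro i hi j hj
    rw [mem_ofPred_eq, mem_Ioc] at hi hj
    have key : ∀ k l : Fin n, s < ((k : ℝ) + 1) / n → ((l : ℝ) + 1) / n ≤ s + 1 / n →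
        (l : ℕ) < k + 1 := by
      intro k l hk hl
      have : ((l : ℝ) + 1) / n < ((k : ℝ) + 1 + 1) / n := by
        rw [add_div (_ + 1) 1]; linarith
      rw [div_lt_div_iff_of_pos_right hn0] at this
      exact_mod_cast (by linarith : (l : ℝ) < k + 1)
    have := key i j hi.1 hj.2
    have := key j i hj.1 hi.2
    exact Fin.ext (by omega)

theorem isDesignIntensity_designRD {n : ℕ} (hn : 0 < n) :
    IsDesignIntensity (designRD n) ((n : ℝ≥0∞) • (volume : Measure ℝ).restrict (Icc 0 1)) := by
  have hn0 : (0 : ℝ) < n := by exact_mod_cast hn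
  have := isProbabilityMeasure_restrict_Icc
  have hfin : IsFiniteMeasure ((n : ℝ≥0∞) • (volume : Measure ℝ).restrict (Icc 0 1)) :=
    Measure.smul_finite _ (by simp)
  refine ⟨hfin, ?_, ?_, ?_⟩
  · intro h hm h1 hi
    have hm' : Measurable fun t => ENNReal.ofReal (1 + h t) := (hm.const_add 1).ennreal_ofReal
    have hmeas : Measurable fun x : Fin n → ℝ => ∏ i, ENNReal.ofReal (1 + h (x i)) :=
      Finset.measurable_prod _ fun i _ => hm'.comp (measurable_pi_apply i)
    have hsort : ∀ x : Fin n → ℝ, ∏ i, ENNReal.ofReal (1 + h (reorder x i)) =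
        ∏ i, ENNReal.ofReal (1 + h (x i)) := fun x =>
      Equiv.prod_comp (Tuple.sort x) fun i => ENNReal.ofReal (1 + h (x i))
    have hi' : Integrable h ((volume : Measure ℝ).restrict (Icc 0 1)) :=
      (integrable_smul_measure (by exact_mod_cast hn.ne') (by simp)).1 hi
    rw [designRD, lintegral_map hmeas measurable_reorder]
    simp only [hsort]
    rw [lintegral_pi_prod_eq _ fun _ => hm', Finset.prod_const, Finset.card_univ,
      Fintype.card_fin,
      ← ofReal_integral_eq_lintegral_ofReal (f := fun t => 1 + h t)
        ((integrable_const 1).add hi') (ae_of_all _ fun x => neg_le_iff_add_nonneg'.1 (h1 x)),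
      integral_add (integrable_const 1) hi', integral_smul_measure]
    have hI : -1 ≤ ∫ x in Icc (0 : ℝ) 1, h x := by
      have := integral_mono (integrable_const (-1)) hi' h1
      simpa using this
    simp only [integral_const, probReal_univ, smul_eq_mul, one_mul, ENNReal.toReal_natCast]
    rw [← ENNReal.ofReal_pow (by linarith), Real.exp_nat_mul]
    refine ENNReal.ofReal_le_ofReal (pow_le_pow_left₀ (by linarith) ?_ n)
    rw [add_comm]; exact Real.add_one_le_exp _
  · intro p q hpq hq
    have hsub : Ioc (p / n : ℝ) (q / n) ⊆ Icc 0 1 := fun x hx =>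
      ⟨le_trans (by positivity) hx.1.le, hx.2.trans
        ((div_le_one hn0).2 (by exact_mod_cast hq))⟩
    have : (p : ℝ) ≤ q := by exact_mod_cast hpq
    rw [measureReal_ennreal_smul_apply, measureReal_restrict_apply measurableSet_Ioc,
      inter_eq_left.2 hsub, Real.volume_real_Ioc_of_le (by gcongr)]
    simp; field_simp
  · intro s
    rw [measureReal_ennreal_smul_apply]
    calc (n : ℝ≥0∞).toReal * ((volume : Measure ℝ).restrict (Icc 0 1)).real (Ioc s (s + 1 / n))
        ≤ n * (volume : Measure ℝ).real (Ioc s (s + 1 / n)) := by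
          rw [ENNReal.toReal_natCast]
          gcongr
          exact ENNReal.toReal_mono (by simp) (Measure.restrict_le_self _)
      _ = 1 := by
          rw [Real.volume_real_Ioc_of_le (by simp)]
          field_simp; ring

theorem gap_designDD {n : ℕ} (hn : 0 < n) :
    2⁻¹ ≤ designDD n {x | ∀ i, x i ∉ Ioc (1 - 3 / (4 * n) : ℝ) (1 - 1 / (4 * n))} := by
  have hn0 : (0 : ℝ) < n := by exact_mod_cast hn
  rw [designDD, Measure.dirac_apply_of_mem]
  · simp
  · rintro i ⟨h1, h2⟩
    rw [lt_div_iff₀ hn0] at h1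
    rw [div_le_iff₀ hn0] at h2
    have e1 : (1 - 3 / (4 * n) : ℝ) * n = n - 3 / 4 := by field_simp
    have e2 : (1 - 1 / (4 * n) : ℝ) * n = n - 1 / 4 := by field_simp
    rw [e1] at h1
    rw [e2] at h2
    have h3 : n < (i : ℕ) + 1 + 1 := by exact_mod_cast (by linarith : (n : ℝ) < i + 1 + 1)
    have h4 : (i : ℕ) + 1 < n := by exact_mod_cast (by linarith : (i : ℝ) + 1 < n)
    omega

theorem gap_designRD {n : ℕ} (hn : 0 < n) :
    2⁻¹ ≤ designRD n {x | ∀ i, x i ∉ Ioc (1 - 3 / (4 * n) : ℝ) (1 - 1 / (4 * n))} := by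
  have hn1 : (1 : ℝ) ≤ n := by exact_mod_cast hn
  have := isProbabilityMeasure_restrict_Icc
  set I := Ioc (1 - 3 / (4 * n) : ℝ) (1 - 1 / (4 * n)) with hI
  have hpre : reorder ⁻¹' {x : Fin n → ℝ | ∀ i, x i ∉ I} = univ.pi fun _ => Iᶜ := by
    ext x
    simp only [mem_preimage, mem_ofPred_eq, mem_univ_pi, mem_compl_iff]
    exact (Tuple.sort x).forall_congr_left.trans (by simp [reorder])
  have hm : MeasurableSet {x : Fin n → ℝ | ∀ i, x i ∉ I} := by
    simp only [Set.ofPred_forall]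
    exact MeasurableSet.iInter fun i => (measurable_pi_apply i) measurableSet_Ioc.compl
  rw [designRD, Measure.map_apply measurable_reorder hm, hpre, Measure.pi_pi, Finset.prod_const,
    Finset.card_univ, Fintype.card_fin]
  have hI1 : (volume.restrict (Icc 0 1)).real I ≤ 1 / (2 * n) := by
    refine (ENNReal.toReal_mono (by simp [hI]) (Measure.restrict_le_self _)).trans ?_
    change (volume : Measure ℝ).real I ≤ _
    rw [hI, Real.volume_real_Ioc_of_le]
    · apply le_of_eq; field_simp; norm_num
    · gcongr; norm_num
  have hb : 1 / 2 ≤ (1 - 1 / (2 * n) : ℝ) ^ n := by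
    have := one_add_mul_le_pow (a := (-(1 / (2 * n)) : ℝ)) (by
      have : (1 : ℝ) / (2 * n) ≤ 1 := by rw [div_le_one (by positivity)]; linarith
      linarith) n
    have e : (n : ℝ) * -(1 / (2 * n)) = - (1 / 2) := by field_simp
    rw [e] at this
    rw [sub_eq_add_neg]; linarith
  have hc : ENNReal.ofReal (1 - 1 / (2 * n)) ≤ volume.restrict (Icc 0 1) Iᶜ := by
    rw [← ofReal_measureReal, probReal_compl_eq_one_sub measurableSet_Ioc]
    exact ENNReal.ofReal_le_ofReal (by linarith)
  calc (2⁻¹ : ℝ≥0∞) = ENNReal.ofReal (1 / 2) := by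
        rw [one_div, ENNReal.ofReal_inv_of_pos (by norm_num)]; simp
    _ ≤ ENNReal.ofReal ((1 - 1 / (2 * n)) ^ n) := ENNReal.ofReal_le_ofReal hb
    _ = ENNReal.ofReal (1 - 1 / (2 * n)) ^ n := ENNReal.ofReal_pow (by
        have : (1 : ℝ) / (2 * n) ≤ 1 := by rw [div_le_one (by positivity)]; linarith
        linarith) n
    _ ≤ _ := by gcongr

/-! ### Scores and their exponential moments -/

/-- The score of a set `A`: up to terms that do not depend on `A`, it is `-1 / 2` times the residual
sum of squares of the model `Y_i = 1(X_i ∈ A) + ξ_i`. -/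
noncomputable def score {n : ℕ} (A : Set ℝ) (z : Fin n → ℝ × ℝ) : ℝ :=
  ∑ i, A.indicator 1 (z i).1 * ((z i).2 - 1 / 2)

theorem measurable_score {n : ℕ} {A : Set ℝ} (hA : MeasurableSet A) :
    Measurable (score A : (Fin n → ℝ × ℝ) → ℝ) := by
  refine Finset.measurable_sum _ fun i _ => ?_
  exact ((measurable_one.indicator hA).comp (measurable_pi_apply i).fst).mul
    ((measurable_pi_apply i).snd.sub_const _)

theorem exists_measurable_argmax {Ω ι : Type*} [MeasurableSpace Ω] [MeasurableSpace ι]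
    (S : ι → Ω → ℝ) (hS : ∀ j, Measurable (S j)) {J : Finset ι} (hJ : J.Nonempty) :
    ∃ τ : Ω → ι, Measurable τ ∧ (∀ ω, τ ω ∈ J) ∧ ∀ ω, ∀ j ∈ J, S j ω ≤ S (τ ω) ω := by
  suffices ∃ τ : Ω → ι, Measurable τ ∧ Measurable (fun ω => S (τ ω) ω) ∧ (∀ ω, τ ω ∈ J) ∧
      ∀ ω, ∀ j ∈ J, S j ω ≤ S (τ ω) ω by
    obtain ⟨τ, h1, -, h2⟩ := this
    exact ⟨τ, h1, h2⟩
  induction hJ using Finset.Nonempty.cons_induction with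
  | singleton a =>
    exact ⟨fun _ => a, measurable_const, hS a, by simp, by simp⟩
  | cons a s ha hs ih =>
    classical
    obtain ⟨τ, h1, h2, h3, h4⟩ := ih
    have hset : MeasurableSet {ω | S (τ ω) ω ≤ S a ω} := measurableSet_le h2 (hS a)
    refine ⟨fun ω => if S (τ ω) ω ≤ S a ω then a else τ ω,
      Measurable.ite hset measurable_const h1, ?_, ?_, ?_⟩
    · have : (fun ω => S (if S (τ ω) ω ≤ S a ω then a else τ ω) ω) =
          fun ω => max (S (τ ω) ω) (S a ω) := by
        funext ω
        split_ifs with h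
        · rw [max_eq_right h]
        · rw [max_eq_left (not_le.1 h).le]
      rw [this]
      exact h2.max (hS a)
    · intro ω
      dsimp only
      split_ifs
      · simp
      · simp [h3 ω]
    · intro ω j hj
      rw [Finset.mem_cons] at hj
      dsimp only
      rcases hj with rfl | hj
      · split_ifs with h
        · exact le_rfl
        · exact (not_le.1 h).le
      · split_ifs with h
        · exact (h4 ω j hj).trans h
        · exact h4 ω j hj

/-- The factor `𝔼 exp(t (ξ - 1 / 2)) ≤ exp(-1 / (8 σ²))` gained at the optimal `t = 1 / (2 σ²)` from
a design point that a wrong segment misclassifies. -/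
noncomputable def gainFactor (σ : ℝ≥0) : ℝ := Real.exp (-(1 / (8 * (σ : ℝ) ^ 2)))

/-- The factor lost, for the same `t`, from a design point that the reference segment itself
misclassifies. -/
noncomputable def lossFactor (σ : ℝ≥0) : ℝ := Real.exp (3 / (8 * (σ : ℝ) ^ 2))

theorem gainFactor_lt_one {σ : ℝ≥0} (hσ : 0 < σ) : gainFactor σ < 1 := by
  have : (0 : ℝ) < σ := hσ
  rw [gainFactor, Real.exp_lt_one_iff, neg_lt_zero]
  positivity

theorem gainFactor_pos (σ : ℝ≥0) : 0 < gainFactor σ := Real.exp_pos _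

theorem one_le_lossFactor (σ : ℝ≥0) : 1 ≤ lossFactor σ := Real.one_le_exp (by positivity)

theorem lintegral_exp_affine_le {ν : Measure ℝ} {c : ℝ≥0} (h : HasSubgaussianMGF id c ν)
    (t d : ℝ) : ∫⁻ ξ, ENNReal.ofReal (Real.exp (t * ξ + d)) ∂ν ≤
      ENNReal.ofReal (Real.exp (c * t ^ 2 / 2 + d)) := by
  have hi : Integrable (fun ξ => Real.exp (t * ξ + d)) ν := by
    simp only [Real.exp_add]
    exact (h.integrable_exp_mul t).mul_const _
  rw [← ofReal_integral_eq_lintegral_ofReal hi (ae_of_all _ fun _ => (Real.exp_pos _).le)]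
  refine ENNReal.ofReal_le_ofReal ?_
  simp only [Real.exp_add, integral_mul_const]
  exact mul_le_mul_of_nonneg_right (h.mgf_le t) (Real.exp_pos _).le

/-- The contribution of one design point `x` to the exponential moment of
`score B - score A`. -/
theorem lintegral_exp_score_term_le {ν : Measure ℝ} [IsProbabilityMeasure ν] {σ : ℝ≥0}
    (hσ : 0 < σ) (hν : HasSubgaussianMGF id (σ ^ 2) ν) {G A B : Set ℝ} (hAG : A ⊆ G) (x : ℝ) :
    ∫⁻ ξ, ENNReal.ofReal (Real.exp (1 / (2 * (σ : ℝ) ^ 2) *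
        ((B.indicator 1 x - A.indicator 1 x) * (G.indicator 1 x + ξ - 1 / 2)))) ∂ν ≤
      ENNReal.ofReal (1 + ((lossFactor σ - gainFactor σ) * (G \ A).indicator 1 x -
        (1 - gainFactor σ) * (symmDiff A B).indicator 1 x)) := by
  have hσ' : (0 : ℝ) < σ := hσ
  have hM := one_le_lossFactor σ
  have hρ := gainFactor_lt_one hσ
  have aff : ∀ (t d u : ℝ) (f : ℝ → ℝ), (∀ ξ, f ξ = t * ξ + d) →
      ((σ ^ 2 : ℝ≥0) : ℝ) * t ^ 2 / 2 + d ≤ u →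
      ∫⁻ ξ, ENNReal.ofReal (Real.exp (f ξ)) ∂ν ≤ ENNReal.ofReal (Real.exp u) := by
    intro t d u f hf hu
    simp only [hf]
    exact (lintegral_exp_affine_le hν t d).trans
      (ENNReal.ofReal_le_ofReal (Real.exp_le_exp.2 hu))
  by_cases hB : x ∈ B <;> by_cases hA : x ∈ A
  · have hG := hAG hA
    simp [hB, hA, hG, mem_symmDiff]
  · by_cases hG : x ∈ G
    · have e : 1 + ((lossFactor σ - gainFactor σ) * (G \ A).indicator 1 x -
          (1 - gainFactor σ) * (symmDiff A B).indicator 1 x) = lossFactor σ := by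
        simp [hB, hA, hG, mem_symmDiff]
      rw [e]
      refine aff (1 / (2 * (σ : ℝ) ^ 2)) (1 / (2 * (σ : ℝ) ^ 2) * (1 / 2)) _ _ (fun ξ => ?_) ?_
      · simp [hB, hA, hG]; ring
      · push_cast; apply le_of_eq; field_simp; norm_num
    · have e : 1 + ((lossFactor σ - gainFactor σ) * (G \ A).indicator 1 x -
          (1 - gainFactor σ) * (symmDiff A B).indicator 1 x) = gainFactor σ := by
        simp [hB, hA, hG, mem_symmDiff]
      rw [e]
      refine aff (1 / (2 * (σ : ℝ) ^ 2)) (-(1 / (2 * (σ : ℝ) ^ 2) * (1 / 2))) _ _ (fun ξ => ?_) ?_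
      · simp [hB, hA, hG]; ring
      · push_cast; apply le_of_eq; field_simp; norm_num
  · have hG := hAG hA
    have e : 1 + ((lossFactor σ - gainFactor σ) * (G \ A).indicator 1 x -
        (1 - gainFactor σ) * (symmDiff A B).indicator 1 x) = gainFactor σ := by
      simp [hB, hA, hG, mem_symmDiff]
    rw [e]
    refine aff (-(1 / (2 * (σ : ℝ) ^ 2))) (-(1 / (2 * (σ : ℝ) ^ 2) * (1 / 2))) _ _ (fun ξ => ?_) ?_
    · simp [hB, hA, hG]; ring
    · push_cast; apply le_of_eq; field_simp; norm_num
  · by_cases hG : x ∈ G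
    · simp [hB, hA, hG, mem_symmDiff]; linarith
    · simp [hB, hA, hG, mem_symmDiff]

/-- Chernoff bound for the event that a wrong set `B` scores higher than the reference `A ⊆ G`: its
probability decays exponentially in the number of design points that separate `A` and `B`. -/
theorem lintegral_exp_score_sub_le {n : ℕ} {D : Measure (Fin n → ℝ)} [SFinite D] {κ : Measure ℝ}
    (hD : IsDesignIntensity D κ) {ν : Measure ℝ} [IsProbabilityMeasure ν] {σ : ℝ≥0} (hσ : 0 < σ)
    (hν : HasSubgaussianMGF id (σ ^ 2) ν) {G A B : Set ℝ} (hG : MeasurableSet G)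
    (hA : MeasurableSet A) (hB : MeasurableSet B) (hAG : A ⊆ G) :
    ∫⁻ z, ENNReal.ofReal (Real.exp (1 / (2 * (σ : ℝ) ^ 2) * (score B z - score A z)))
        ∂(obsLaw D ν G) ≤
      ENNReal.ofReal (Real.exp ((lossFactor σ - gainFactor σ) * κ.real (G \ A) -
        (1 - gainFactor σ) * κ.real (symmDiff A B))) := by
  have := hD.isFiniteMeasure
  have hM := one_le_lossFactor σ
  have hρ := gainFactor_lt_one hσ
  have hρ0 := gainFactor_pos σ
  set h : ℝ → ℝ := fun x => (lossFactor σ - gainFactor σ) * (G \ A).indicator 1 x -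
    (1 - gainFactor σ) * (symmDiff A B).indicator 1 x with hh
  have hmG : MeasurableSet (G \ A) := hG.diff hA
  have hmS : MeasurableSet (symmDiff A B) := hA.symmDiff hB
  have hmeas : Measurable h := ((measurable_one.indicator hmG).const_mul _).sub
    ((measurable_one.indicator hmS).const_mul _)
  have hi1 : Integrable ((G \ A).indicator (1 : ℝ → ℝ)) κ :=
    (integrable_const (1 : ℝ)).indicator hmG
  have hi2 : Integrable ((symmDiff A B).indicator (1 : ℝ → ℝ)) κ :=
    (integrable_const (1 : ℝ)).indicator hmS
  have hint : Integrable h κ := (hi1.const_mul _).sub (hi2.const_mul _)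
  have hge : ∀ x, -1 ≤ h x := by
    intro x
    have h1 : 0 ≤ (G \ A).indicator (1 : ℝ → ℝ) x := indicator_nonneg (by simp) x
    have h2 : (symmDiff A B).indicator (1 : ℝ → ℝ) x ≤ 1 := by
      by_cases hx : x ∈ symmDiff A B <;> simp [hx]
    have h3 : 0 ≤ (symmDiff A B).indicator (1 : ℝ → ℝ) x := indicator_nonneg (by simp) x
    simp only [hh]
    nlinarith
  have hval : ∫ x, h x ∂κ = (lossFactor σ - gainFactor σ) * κ.real (G \ A) -
      (1 - gainFactor σ) * κ.real (symmDiff A B) := by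
    rw [hh, integral_sub (hi1.const_mul _) (hi2.const_mul _), integral_const_mul,
      integral_const_mul, integral_indicator_one hmG, integral_indicator_one hmS]
  rw [← hval]
  -- The contribution of a design point `x` with noise `ξ`.
  set φ : ℝ → ℝ → ℝ≥0∞ := fun x ξ => ENNReal.ofReal (Real.exp (1 / (2 * (σ : ℝ) ^ 2) *
    ((B.indicator 1 x - A.indicator 1 x) * (G.indicator 1 x + ξ - 1 / 2)))) with hφ
  have hφm : ∀ x, Measurable (φ x) := fun x => by simp only [hφ]; fun_prop
  have hprod : ∀ p : (Fin n → ℝ) × (Fin n → ℝ),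
      ENNReal.ofReal (Real.exp (1 / (2 * (σ : ℝ) ^ 2) *
        (score B (observe G p.1 p.2) - score A (observe G p.1 p.2)))) =
      ∏ i, φ (p.1 i) (p.2 i) := by
    intro p
    rw [hφ, ← ENNReal.ofReal_prod_of_nonneg fun i _ => (Real.exp_pos _).le, ← Real.exp_sum,
      score, score, ← Finset.sum_sub_distrib, Finset.mul_sum]
    simp only [observe, sub_mul]
  have hSm : Measurable fun z : Fin n → ℝ × ℝ =>
      ENNReal.ofReal (Real.exp (1 / (2 * (σ : ℝ) ^ 2) * (score B z - score A z))) :=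
    (Real.measurable_exp.comp
      (((measurable_score hB).sub (measurable_score hA)).const_mul _)).ennreal_ofReal
  have hobs := measurable_observe (n := n) hG
  have hSo : Measurable fun p : (Fin n → ℝ) × (Fin n → ℝ) =>
      ENNReal.ofReal (Real.exp (1 / (2 * (σ : ℝ) ^ 2) *
        (score B (observe G p.1 p.2) - score A (observe G p.1 p.2)))) := hSm.comp hobs
  rw [obsLaw, lintegral_map hSm hobs, lintegral_prod _ hSo.aemeasurable]
  refine le_trans (lintegral_mono fun x => ?_) (hD.lintegral_prod_le h hmeas hge hint)
  rw [lintegral_congr fun ξ => hprod (x, ξ), lintegral_pi_prod_eq ν fun i => hφm (x i)]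
  exact Finset.prod_le_prod' fun i _ => lintegral_exp_score_term_le hσ hν hAG (x i)

/-! ### Risk of the least squares estimator -/

/-- The number of design points that separate a grid segment from a long reference grid segment is
at least a constant times the sum of the distances of their endpoints. This holds even for disjoint
segments: then all of the reference segment separates them, and its length is of order one. -/
theorem IsDesignIntensity.le_real_symmDiff {n : ℕ} {D : Measure (Fin n → ℝ)} {κ : Measure ℝ}
    (hD : IsDesignIntensity D κ) (hn : 0 < n) {μ : ℝ} (hμ1 : μ ≤ 1) {p q p' q' : ℕ} (hpq : p ≤ q)
    (hq : q ≤ n) (hpq' : p' ≤ q') (hq' : q' ≤ n) (hlong : μ * n / 2 ≤ q - p) :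
    μ / 4 * (|(p : ℝ) - p'| + |(q : ℝ) - q'|) ≤
      κ.real (symmDiff (Ioc (p / n : ℝ) (q / n)) (Ioc (p' / n) (q' / n))) := by
  have := hD.isFiniteMeasure
  have hn0 : (0 : ℝ) < n := by exact_mod_cast hn
  have hpqr : (p : ℝ) ≤ q := by exact_mod_cast hpq
  have hpqr' : (p' : ℝ) ≤ q' := by exact_mod_cast hpq'
  have hqr : (q : ℝ) ≤ n := by exact_mod_cast hq
  have hqr' : (q' : ℝ) ≤ n := by exact_mod_cast hq'
  have hp0 : (0 : ℝ) ≤ p := by positivity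
  have hp0' : (0 : ℝ) ≤ p' := by positivity
  have hb1 : |(p : ℝ) - p'| ≤ n := abs_le.2 ⟨by linarith, by linarith⟩
  have hb2 : |(q : ℝ) - q'| ≤ n := abs_le.2 ⟨by linarith, by linarith⟩
  have mono : ∀ {i j : ℕ}, i ≤ j → (i / n : ℝ) ≤ j / n := fun h => by gcongr
  have fin : ∀ s : Set ℝ, κ s ≠ ∞ := fun s => measure_ne_top κ s
  by_cases hdis : p' ≤ q ∧ p ≤ q'
  · obtain ⟨h1, h2⟩ := hdis
    -- The two segments overlap: the cells between the endpoints lie in the symmetric difference.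
    have hsub : Ioc ((min p p' : ℕ) / n : ℝ) ((max p p' : ℕ) / n) ∪
        Ioc ((min q q' : ℕ) / n : ℝ) ((max q q' : ℕ) / n) ⊆
        symmDiff (Ioc (p / n : ℝ) (q / n)) (Ioc (p' / n) (q' / n)) := by
      have m1 := mono h1
      have m2 := mono h2
      have m3 := mono hpq
      have m4 := mono hpq'
      rintro x (⟨hx1, hx2⟩ | ⟨hx1, hx2⟩)
      · rcases le_total p p' with h | h
        · simp only [min_eq_left h, max_eq_right h] at hx1 hx2
          exact Or.inl ⟨⟨hx1, hx2.trans m1⟩, fun hx => hx.1.not_ge hx2⟩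
        · simp only [min_eq_right h, max_eq_left h] at hx1 hx2
          exact Or.inr ⟨⟨hx1, hx2.trans m2⟩, fun hx => hx.1.not_ge hx2⟩
      · rcases le_total q q' with h | h
        · simp only [min_eq_left h, max_eq_right h] at hx1 hx2
          exact Or.inr ⟨⟨m1.trans_lt hx1, hx2⟩, fun hx => hx1.not_ge hx.2⟩
        · simp only [min_eq_right h, max_eq_left h] at hx1 hx2
          exact Or.inl ⟨⟨m2.trans_lt hx1, hx2⟩, fun hx => hx1.not_ge hx.2⟩
    have hdisj : Disjoint (Ioc ((min p p' : ℕ) / n : ℝ) ((max p p' : ℕ) / n))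
        (Ioc ((min q q' : ℕ) / n : ℝ) ((max q q' : ℕ) / n)) := by
      rw [Set.disjoint_left]
      intro x hx hx'
      have : (max p p' : ℕ) ≤ min q q' := by omega
      exact (hx.2.trans (mono this)).not_gt hx'.1
    have habs : ∀ i j : ℕ, ((max i j : ℕ) : ℝ) - (min i j : ℕ) = |(i : ℝ) - j| := by
      intro i j
      rw [Nat.cast_max, Nat.cast_min, max_sub_min_eq_abs']
    have hκ : |(p : ℝ) - p'| + |(q : ℝ) - q'| ≤
        κ.real (symmDiff (Ioc (p / n : ℝ) (q / n)) (Ioc (p' / n) (q' / n))) := by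
      rw [← habs, ← habs, ← hD.real_Ioc_grid (min p p') (max p p') (by omega) (by omega),
        ← hD.real_Ioc_grid (min q q') (max q q') (by omega) (by omega),
        ← measureReal_union hdisj measurableSet_Ioc]
      exact measureReal_mono hsub
    refine le_trans ?_ hκ
    have : 0 ≤ |(p : ℝ) - p'| + |(q : ℝ) - q'| := by positivity
    nlinarith
  · -- The two segments are disjoint: the whole reference segment is lost.
    have hsub : Ioc (p / n : ℝ) (q / n) ⊆
        symmDiff (Ioc (p / n : ℝ) (q / n)) (Ioc (p' / n) (q' / n)) := by
      intro x hx
      refine Or.inl ⟨hx, fun hx' => hdis ⟨?_, ?_⟩⟩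
      · have := hx'.1.trans_le hx.2
        rw [div_lt_div_iff_of_pos_right hn0] at this
        exact_mod_cast this.le
      · have := hx.1.trans_le hx'.2
        rw [div_lt_div_iff_of_pos_right hn0] at this
        exact_mod_cast this.le
    have h1 := measureReal_mono (μ := κ) hsub
    rw [hD.real_Ioc_grid p q hpq hq] at h1
    refine le_trans ?_ h1
    rcases le_total μ 0 with hμ | hμ
    · have : 0 ≤ |(p : ℝ) - p'| + |(q : ℝ) - q'| := by positivity
      nlinarith
    · nlinarith

theorem volume_symmDiff_Icc_le (a b c d : ℝ) :
    volume (symmDiff (Icc a b) (Icc c d)) ≤ ENNReal.ofReal (|a - c| + |b - d|) := by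
  have hsub : symmDiff (Icc a b) (Icc c d) ⊆ uIcc a c ∪ uIcc b d := by
    rintro x (⟨⟨h1, h2⟩, h3⟩ | ⟨⟨h1, h2⟩, h3⟩)
    all_goals
      simp only [mem_Icc, not_and_or, not_le] at h3
      simp only [mem_union, mem_uIcc]
      rcases h3 with h3 | h3
      · simp [h1, h3.le]
      · simp [h2, h3.le]
  refine (measure_mono hsub).trans ((measure_union_le _ _).trans ?_)
  rw [Real.volume_interval, Real.volume_interval, ENNReal.ofReal_add (abs_nonneg _) (abs_nonneg _),
    abs_sub_comm a, abs_sub_comm b]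

theorem sum_exp_neg_mul_abs_sub_le {s : ℝ} (hs : 0 < s) (p m : ℕ) :
    ∑ k ∈ Finset.range m, Real.exp (-(s * |(p : ℝ) - k|)) ≤ 2 / (1 - Real.exp (-s)) := by
  set r := Real.exp (-s) with hr
  have hr0 : 0 ≤ r := (Real.exp_pos _).le
  have hr1 : r < 1 := by rw [hr, Real.exp_lt_one_iff]; linarith
  have geom : ∀ k : ℕ, ∑ j ∈ Finset.range k, r ^ j ≤ 1 / (1 - r) := fun k => by
    rw [one_div, ← tsum_geometric_of_lt_one hr0 hr1]
    exact (summable_geometric_of_lt_one hr0 hr1).sum_le_tsum _ fun j _ => pow_nonneg hr0 j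
  have hpow : ∀ j : ℕ, Real.exp (-(s * j)) = r ^ j := fun j => by
    rw [hr, ← Real.exp_nat_mul]; ring_nf
  calc ∑ k ∈ Finset.range m, Real.exp (-(s * |(p : ℝ) - k|))
      ≤ ∑ k ∈ Finset.range (p + 1 + m), Real.exp (-(s * |(p : ℝ) - k|)) :=
        Finset.sum_le_sum_of_subset_of_nonneg (Finset.range_subset_range.2 (by omega))
          fun _ _ _ => (Real.exp_pos _).le
    _ = ∑ k ∈ Finset.range (p + 1), Real.exp (-(s * |(p : ℝ) - k|)) +
        ∑ j ∈ Finset.range m, Real.exp (-(s * |(p : ℝ) - (p + 1 + j : ℕ)|)) :=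
        Finset.sum_range_add _ _ _
    _ ≤ ∑ j ∈ Finset.range (p + 1), r ^ j + ∑ j ∈ Finset.range m, r ^ j := by
        refine add_le_add (le_of_eq ?_) (Finset.sum_le_sum fun j _ => ?_)
        · rw [← Finset.sum_flip]
          refine Finset.sum_congr rfl fun k hk => ?_
          have hk' : k ≤ p := Nat.lt_succ_iff.1 (Finset.mem_range.1 hk)
          have : (k : ℝ) ≤ p := by exact_mod_cast hk'
          rw [← hpow, Nat.cast_sub hk', abs_of_nonneg (by linarith),
            sub_sub_cancel]
        · rw [← hpow, Real.exp_le_exp, neg_le_neg_iff]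
          refine mul_le_mul_of_nonneg_left ?_ hs.le
          push_cast
          rw [abs_sub_comm]
          exact le_trans (by linarith) (le_abs_self _)
    _ ≤ 1 / (1 - r) + 1 / (1 - r) := add_le_add (geom _) (geom _)
    _ = 2 / (1 - r) := by ring

/-- The series that bounds `n` times the risk: the loss `l + 2` of a segment at grid distance `l`
from the truth, weighted by the probability `exp (-(θ * l))` of selecting it. -/
theorem sum_loss_mul_exp_le {θ : ℝ} (hθ : 0 < θ) (p q m : ℕ) :
    ∑ j ∈ Finset.range m ×ˢ Finset.range m,
      (|(p : ℝ) - j.1| + |(q : ℝ) - j.2| + 2) *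
        Real.exp (-(θ * (|(p : ℝ) - j.1| + |(q : ℝ) - j.2|))) ≤
      (2 + 2 / θ) * (2 / (1 - Real.exp (-(θ / 2)))) ^ 2 := by
  calc _ ≤ ∑ j ∈ Finset.range m ×ˢ Finset.range m, (2 + 2 / θ) *
        (Real.exp (-(θ / 2 * |(p : ℝ) - j.1|)) * Real.exp (-(θ / 2 * |(q : ℝ) - j.2|))) := by
        refine Finset.sum_le_sum fun j _ => ?_
        set l := |(p : ℝ) - j.1| + |(q : ℝ) - j.2| with hl
        have hl0 : 0 ≤ l := by positivity
        have h1 : l + 2 ≤ (2 + 2 / θ) * Real.exp (θ / 2 * l) := by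
          calc l + 2 ≤ (2 + 2 / θ) * (θ / 2 * l + 1) := by
                have : (2 + 2 / θ) * (θ / 2 * l + 1) = l + 2 + (θ * l + 2 / θ) := by
                  field_simp; ring
                rw [this]
                have : 0 ≤ θ * l + 2 / θ := by positivity
                linarith
            _ ≤ _ := by gcongr; exact Real.add_one_le_exp _
        calc (l + 2) * Real.exp (-(θ * l))
            ≤ (2 + 2 / θ) * Real.exp (θ / 2 * l) * Real.exp (-(θ * l)) := by gcongr
          _ = _ := by
            rw [mul_assoc, ← Real.exp_add, ← Real.exp_add, hl]
            congr 2; ring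
    _ = (2 + 2 / θ) * ((∑ k ∈ Finset.range m, Real.exp (-(θ / 2 * |(p : ℝ) - k|))) *
        ∑ k ∈ Finset.range m, Real.exp (-(θ / 2 * |(q : ℝ) - k|))) := by
        rw [← Finset.mul_sum, Finset.sum_mul_sum, Finset.sum_product]
    _ ≤ (2 + 2 / θ) * (2 / (1 - Real.exp (-(θ / 2))) * (2 / (1 - Real.exp (-(θ / 2))))) := by
        have hp := sum_exp_neg_mul_abs_sub_le (half_pos hθ) p m
        have hq := sum_exp_neg_mul_abs_sub_le (half_pos hθ) q m
        refine mul_le_mul_of_nonneg_left (mul_le_mul hp hq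
          (Finset.sum_nonneg fun _ _ => (Real.exp_pos _).le)
          (le_trans (Finset.sum_nonneg fun _ _ => (Real.exp_pos _).le) hp)) (by positivity)
    _ = _ := by rw [sq]

/-- The inner approximation of a long segment by a union of cells of the grid of mesh `1 / n`. -/
theorem exists_grid_approx {a b μ : ℝ} (ha : 0 ≤ a) (hb : b ≤ 1) (hab : μ ≤ b - a) {n : ℕ}
    (hn : 0 < n) (hμ : 4 ≤ μ * n) :
    ∃ p q : ℕ, p ≤ q ∧ q ≤ n ∧ μ * n / 2 ≤ q - p ∧ a ≤ p / n ∧ p / n ≤ a + 1 / n ∧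
      b - 1 / n ≤ q / n ∧ (q / n : ℝ) ≤ b ∧
      Icc a b \ Ioc (p / n : ℝ) (q / n) ⊆
        Ioc ((p - 1) / n : ℝ) ((p - 1) / n + 1 / n) ∪ Ioc (q / n : ℝ) (q / n + 1 / n) := by
  have hn0 : (0 : ℝ) < n := by exact_mod_cast hn
  have hμ0 : 0 < μ := by
    by_contra h
    nlinarith
  have hb0 : 0 ≤ b * n := by
    have : 0 ≤ b := by linarith
    positivity
  have p1 : a * n ≤ ⌈a * n⌉₊ := Nat.le_ceil _
  have p2 : (⌈a * n⌉₊ : ℝ) < a * n + 1 := Nat.ceil_lt_add_one (by positivity)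
  have q1 : (⌊b * n⌋₊ : ℝ) ≤ b * n := Nat.floor_le hb0
  have q2 : b * n < ⌊b * n⌋₊ + 1 := Nat.lt_floor_add_one _
  have hlen : μ * n ≤ b * n - a * n := by nlinarith
  refine ⟨⌈a * n⌉₊, ⌊b * n⌋₊, ?_, ?_, by linarith, ?_, ?_, ?_, ?_, ?_⟩
  · exact_mod_cast (by linarith : (⌈a * n⌉₊ : ℝ) ≤ ⌊b * n⌋₊)
  · exact_mod_cast (by nlinarith : (⌊b * n⌋₊ : ℝ) ≤ n)
  · rwa [le_div_iff₀ hn0]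
  · rw [div_le_iff₀ hn0, add_mul, one_div_mul_cancel hn0.ne']; exact p2.le
  · rw [le_div_iff₀ hn0, sub_mul, one_div_mul_cancel hn0.ne']; linarith
  · rwa [div_le_iff₀ hn0]
  · rintro x ⟨⟨hx1, hx2⟩, hx3⟩
    rcases le_or_gt x (⌈a * n⌉₊ / n) with h | h
    · left
      constructor
      · refine lt_of_lt_of_le ?_ hx1
        rw [div_lt_iff₀ hn0]; linarith
      · rw [← add_div, sub_add_cancel]; exact h
    · right
      refine ⟨not_le.1 fun h' => hx3 ⟨h, h'⟩, hx2.trans ?_⟩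
      rw [← add_div, le_div_iff₀ hn0]; exact q2.le

/-- The least squares estimator over the segments with endpoints in the grid of mesh `1 / n` has
risk `O(1 / n)` for every design that has an intensity. -/
theorem exists_minimaxRisk_le {μ : ℝ} (hμ0 : 0 < μ) (hμ1 : μ < 1) {σ : ℝ≥0} (hσ : 0 < σ) :
    ∃ C : ℝ, 0 < C ∧ ∀ (n : ℕ) (D : Measure (Fin n → ℝ)) (κ : Measure ℝ) (ν : Measure ℝ),
      SFinite D → IsDesignIntensity D κ → IsProbabilityMeasure ν →
      HasSubgaussianMGF id (σ ^ 2) ν → 4 ≤ μ * n →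
      minimaxRisk D ν (longSegments μ) ≤ ENNReal.ofReal (C / n) := by
  have hM := one_le_lossFactor σ
  have hρ := gainFactor_lt_one hσ
  set θ := (1 - gainFactor σ) * (μ / 4) with hθ
  have hθ0 : 0 < θ := mul_pos (by linarith) (by linarith)
  set K := 2 * (lossFactor σ - gainFactor σ)
  set Q := (2 + 2 / θ) * (2 / (1 - Real.exp (-(θ / 2)))) ^ 2 with hQ
  have hr1 : Real.exp (-(θ / 2)) < 1 := by rw [Real.exp_lt_one_iff]; linarith
  have hQ0 : 0 < Q := by
    have : 0 < 1 - Real.exp (-(θ / 2)) := by linarith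
    positivity
  refine ⟨Real.exp K * Q, by positivity, ?_⟩
  intro n D κ ν _ hD _ hν hn
  have := hD.isFiniteMeasure
  have hnpos : 0 < n := by
    rcases Nat.eq_zero_or_pos n with h | h
    · subst h; norm_num at hn
    · exact h
  have hn0 : (0 : ℝ) < n := by exact_mod_cast hnpos
  set J : Finset (ℕ × ℕ) :=
    (Finset.range (n + 1) ×ˢ Finset.range (n + 1)).filter fun j => j.1 ≤ j.2 with hJ
  have memJ : ∀ j : ℕ × ℕ, j ∈ J ↔ j.1 ≤ j.2 ∧ j.2 ≤ n := by
    intro j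
    simp only [hJ, Finset.mem_filter, Finset.mem_product, Finset.mem_range]
    omega
  set A : ℕ × ℕ → Set ℝ := fun j => Ioc (j.1 / n : ℝ) (j.2 / n) with hA
  have hAm : ∀ j, MeasurableSet (A j) := fun j => measurableSet_Ioc
  obtain ⟨τ, hτm, hτJ, hτ⟩ := exists_measurable_argmax
    (fun (j : ℕ × ℕ) (z : Fin n → ℝ × ℝ) => score (A j) z) (fun j => measurable_score (hAm j))
    (J := J) ⟨(0, 0), (memJ _).2 ⟨le_rfl, Nat.zero_le _⟩⟩
  let T : Estimator n :=
    { lo := fun z => (τ z).1 / n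
      hi := fun z => (τ z).2 / n
      measurable_lo := (measurable_of_countable fun j : ℕ × ℕ => (j.1 / n : ℝ)).comp hτm
      measurable_hi := (measurable_of_countable fun j : ℕ × ℕ => (j.2 / n : ℝ)).comp hτm
      lo_nonneg := fun z => by positivity
      hi_le_one := fun z => (div_le_one hn0).2 (by exact_mod_cast ((memJ _).1 (hτJ z)).2) }
  refine (iInf_le _ T).trans (iSup₂_le ?_)
  rintro G ⟨⟨a, b, ha, hab, hb, rfl⟩, hlen⟩
  rw [Real.volume_Icc, ENNReal.ofReal_le_ofReal_iff (by linarith)] at hlen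
  obtain ⟨p, q, hpq, hq, hlong, hap, hpa, hbq, hqb, hdiff⟩ :=
    exists_grid_approx ha hb hlen hnpos hn
  set l : ℕ × ℕ → ℝ := fun j => |(p : ℝ) - j.1| + |(q : ℝ) - j.2| with hl
  have hl0 : ∀ j, 0 ≤ l j := fun j => by positivity
  have hA0 : A (p, q) ⊆ Icc a b := fun x hx => ⟨hap.trans hx.1.le, hx.2.trans hqb⟩
  have hmiss : κ.real (Icc a b \ A (p, q)) ≤ 2 := by
    refine (measureReal_mono hdiff).trans ((measureReal_union_le _ _).trans ?_)
    linarith [hD.real_Ioc_cell_le ((p - 1) / n), hD.real_Ioc_cell_le (q / n)]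
  have hloss : ∀ j : ℕ × ℕ, volume (symmDiff (Icc a b) (Icc (j.1 / n : ℝ) (j.2 / n))) ≤
      ENNReal.ofReal ((l j + 2) / n) := by
    intro j
    refine (volume_symmDiff_Icc_le _ _ _ _).trans (ENNReal.ofReal_le_ofReal ?_)
    have h1 : |a - j.1 / n| ≤ 1 / n + |(p : ℝ) - j.1| / n := by
      refine (abs_sub_le a (p / n) _).trans (add_le_add ?_ (le_of_eq ?_))
      · rw [abs_le]; constructor <;> linarith
      · rw [← sub_div, abs_div, abs_of_pos hn0]
    have h2 : |b - j.2 / n| ≤ 1 / n + |(q : ℝ) - j.2| / n := by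
      refine (abs_sub_le b (q / n) _).trans (add_le_add ?_ (le_of_eq ?_))
      · rw [abs_le]; constructor <;> linarith
      · rw [← sub_div, abs_div, abs_of_pos hn0]
    refine (add_le_add h1 h2).trans (le_of_eq ?_)
    simp only [hl]; ring
  set W : ℕ × ℕ → (Fin n → ℝ × ℝ) → ℝ≥0∞ := fun j z => ENNReal.ofReal
    (Real.exp (1 / (2 * (σ : ℝ) ^ 2) * (score (A j) z - score (A (p, q)) z))) with hW
  have hWm : ∀ j, Measurable (W j) := fun j => (Real.measurable_exp.comp
    (((measurable_score (hAm j)).sub (measurable_score (hAm _))).const_mul _)).ennreal_ofReal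
  have hWint : ∀ j ∈ J, ∫⁻ z, W j z ∂(obsLaw D ν (Icc a b)) ≤
      ENNReal.ofReal (Real.exp K * Real.exp (-(θ * l j))) := by
    intro j hj
    obtain ⟨hj1, hj2⟩ := (memJ j).1 hj
    refine (lintegral_exp_score_sub_le hD hσ hν measurableSet_Icc (hAm _) (hAm j) hA0).trans
      (ENNReal.ofReal_le_ofReal ?_)
    rw [← Real.exp_add, Real.exp_le_exp]
    have h1 := hD.le_real_symmDiff hnpos hμ1.le hpq hq hj1 hj2 hlong
    have h2 : (lossFactor σ - gainFactor σ) * κ.real (Icc a b \ A (p, q)) ≤ K := by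
      rw [mul_comm]
      exact mul_le_mul_of_nonneg_right hmiss (by linarith)
    have h3 : θ * l j ≤ (1 - gainFactor σ) * κ.real (symmDiff (A (p, q)) (A j)) := by
      rw [hθ, mul_assoc]
      exact mul_le_mul_of_nonneg_left h1 (by linarith)
    linarith
  calc ∫⁻ z, volume (symmDiff (Icc a b) (T.seg z)) ∂(obsLaw D ν (Icc a b))
      ≤ ∫⁻ z, ∑ j ∈ J, ENNReal.ofReal ((l j + 2) / n) * W j z ∂(obsLaw D ν (Icc a b)) := by
        refine lintegral_mono fun z => ?_
        -- The selected segment has the largest score, so that its weight is at least one.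
        have h1 : 1 ≤ W (τ z) z := by
          rw [hW, ENNReal.one_le_ofReal]
          refine Real.one_le_exp (mul_nonneg (by positivity) (sub_nonneg.2 ?_))
          exact hτ z (p, q) ((memJ _).2 ⟨hpq, hq⟩)
        calc volume (symmDiff (Icc a b) (T.seg z)) ≤ ENNReal.ofReal ((l (τ z) + 2) / n) :=
              hloss (τ z)
          _ ≤ ENNReal.ofReal ((l (τ z) + 2) / n) * W (τ z) z := le_mul_of_one_le_right' h1
          _ ≤ _ := Finset.single_le_sum
              (f := fun j => ENNReal.ofReal ((l j + 2) / n) * W j z)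
              (fun _ _ => zero_le) (hτJ z)
    _ = ∑ j ∈ J, ENNReal.ofReal ((l j + 2) / n) * ∫⁻ z, W j z ∂(obsLaw D ν (Icc a b)) := by
        rw [lintegral_finsetSum _ fun j _ => (hWm j).const_mul _]
        exact Finset.sum_congr rfl fun j _ => lintegral_const_mul _ (hWm j)
    _ ≤ ∑ j ∈ J, ENNReal.ofReal (Real.exp K / n * ((l j + 2) * Real.exp (-(θ * l j)))) := by
        refine Finset.sum_le_sum fun j hj => ?_
        refine (mul_le_mul_right (hWint j hj) _).trans (le_of_eq ?_)
        rw [← ENNReal.ofReal_mul (by have := hl0 j; positivity)]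
        congr 1; ring
    _ = ENNReal.ofReal (∑ j ∈ J, Real.exp K / n * ((l j + 2) * Real.exp (-(θ * l j)))) :=
        (ENNReal.ofReal_sum_of_nonneg fun j _ => by have := hl0 j; positivity).symm
    _ ≤ ENNReal.ofReal (Real.exp K * Q / n) := by
        refine ENNReal.ofReal_le_ofReal ?_
        rw [← Finset.mul_sum, mul_div_right_comm]
        refine mul_le_mul_of_nonneg_left ?_ (by positivity)
        exact (Finset.sum_le_sum_of_subset_of_nonneg (Finset.filter_subset _ _)
          fun j _ _ => by have := hl0 j; positivity).trans (sum_loss_mul_exp_le hθ0 p q (n + 1))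

end ChangePoint

/-! ### Both designs -/

theorem theorem10 (μ : ℝ) (hμ0 : 0 < μ) (hμ1 : μ < 1) (σ : ℝ≥0) (hσ : 0 < σ) :
    ∃ c C : ℝ, 0 < c ∧ 0 < C ∧ ∃ N : ℕ,
      ∀ (ν : Measure ℝ), IsProbabilityMeasure ν → HasSubgaussianMGF id (σ ^ 2) ν →
        ∀ n : ℕ, N ≤ n →
          (ENNReal.ofReal (c / n) ≤
              ChangePoint.minimaxRisk (ChangePoint.designDD n) ν (ChangePoint.longSegments μ) ∧
            ChangePoint.minimaxRisk (ChangePoint.designDD n) ν (ChangePoint.longSegments μ) ≤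
              ENNReal.ofReal (C / n)) ∧
          (ENNReal.ofReal (c / n) ≤
              ChangePoint.minimaxRisk (ChangePoint.designRD n) ν (ChangePoint.longSegments μ) ∧
            ChangePoint.minimaxRisk (ChangePoint.designRD n) ν (ChangePoint.longSegments μ) ≤
              ENNReal.ofReal (C / n)) := by
  obtain ⟨C, hC, hupper⟩ := ChangePoint.exists_minimaxRisk_le hμ0 hμ1 hσ
  have h1μ : 0 < 1 - μ := sub_pos.2 hμ1
  refine ⟨1 / 8, C, by norm_num, hC, max 1 (max ⌈4 / μ⌉₊ ⌈1 / (1 - μ)⌉₊), ?_⟩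
  intro ν hνp hν n hn
  have hnpos : 0 < n := le_trans (le_max_left _ _) hn
  have h4 : 4 ≤ μ * n := by
    have : 4 / μ ≤ n := Nat.ceil_le.1 ((le_max_left _ _).trans ((le_max_right _ _).trans hn))
    rwa [div_le_iff₀' hμ0] at this
  have h1 : 1 ≤ (1 - μ) * n := by
    have : 1 / (1 - μ) ≤ n := Nat.ceil_le.1 ((le_max_right _ _).trans ((le_max_right _ _).trans hn))
    rwa [div_le_iff₀' h1μ] at this
  have hDD : SFinite (ChangePoint.designDD n) := by
    unfold ChangePoint.designDD; infer_instance
  have hRD : SFinite (ChangePoint.designRD n) := by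
    unfold ChangePoint.designRD; infer_instance
  exact ⟨⟨ChangePoint.le_minimaxRisk_of_gap _ ν hμ1 h1 hμ0 (ChangePoint.gap_designDD hnpos),
      hupper n _ _ ν hDD (ChangePoint.isDesignIntensity_designDD hnpos) hνp hν h4⟩,
    ⟨ChangePoint.le_minimaxRisk_of_gap _ ν hμ1 h1 hμ0 (ChangePoint.gap_designRD hnpos),
      hupper n _ _ ν hRD (ChangePoint.isDesignIntensity_designRD hnpos) hνp hν h4⟩⟩
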